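/- Let $V=\bigoplus_{n\ge 0}V_n$ be a vertex operator algebra over $\mathbb{C}$ of central charge $C$, with $\dim V_n<\infty$, $V_0=\mathbb{C}\mathbf{1}$, vertex operators $Y(a,z)=\sum_{n\in\mathbb{Z}}a_nz^{-n-1}$ and Virasoro operators $L_n$. Suppose $V$ has a Li--Zamolodchikov metric $\langle\,,\rangle$, i.e. a nondegenerate symmetric bilinear form with $\langle\mathbf{1},\mathbf{1}\rangle=1$ and $\langle Y(e^{zL_1}(-z^{-2})^{L_0}c,z^{-1})a,b\rangle=\langle a,Y(c,z)b\rangle$ for all $a,b,c\in V$. Let $\mathfrak{g}=V_1$ with Lie bracket $[a,b]=a_0b$, let $d_1=\dim\mathfrak{g}$, and let $K(a,b)=\mathrm{Tr}_{\mathfrak g}(a_0b_0)$ be its Killing form. Let $\{u_\alpha\}$ be a basis of $V_1$, $\{u^\alpha\}$ its dual basis with respect to $\langle\,,\rangle$, and $\lambda^{(2)}=\sum_\alpha u^\alpha_{-1}u_\alpha\in V_2$. Let $V_2(C,0)\subseteq V_2$ be the space of weight-two Virasoro descendants $L_{-n_1}\cdots L_{-n_k}\mathbf{1}$ ($n_i\ge1$,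 $\sum n_i=2$) of the vacuum. If $\lambda^{(2)}\in V_2(C,0)$ and $C\neq 0$, then $$K(a,b)=-2\langle a,b\rangle\left(\frac{d_1}{C}-1\right)\qquad(a,b\in\mathfrak{g}).$$ Hence $\mathfrak{g}$ is solvable if $d_1=C$. If $d_1\neq C$, then $\mathfrak{g}$ is semisimple, say $\mathfrak{g}=\mathfrak{g}_1\oplus\dots\oplus\mathfrak{g}_r$ with simple ideals $\mathfrak{g}_i$; the modes of $\mathfrak g_i$ and $\mathfrak g_j$ commute for $i\ne j$, and the modes of $\mathfrak{g}_i$ form an affine Kac--Moody algebra of level $k_i$: for $a,b\in\mathfrak{g}_i$ and $m,n\in\mathbb{Z}$, $$[a_m,b_n]=[a,b]_{m+n}+m\,k_i\,(a,b)_i\,\delta_{m+n,0},$$ where $(\,,)_i$ is the invariant symmetric form on $\mathfrak{g}_i$ for which long roots have squared length $2$. Here $k_i=-\tfrac12\langle\alpha_i,\alpha_i\rangle$ for any long root $\alpha_i$ of $\mathfrak g_i$ with respect to a Cartan subalgebra, where $\alpha_i$ is identified with an element of the Cartan subalgebra by means of $(\,,)_i$ (so that it becomes the coroot $\alpha_i^\vee$).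 The dual Coxeter number $h_i^\vee$ of $\mathfrak{g}_i$ (one plus the sum of the coefficients of $\theta_i^\vee$ in the simple coroots, $\theta_i$ being the highest root) is $$h_i^\vee=k_i\left(\frac{d_1}{C}-1\right).$$ -/

import Mathlib

open Module

noncomputable section

/-- A vertex algebra over `ℂ`: a state-field correspondence `Y(a, z) = ∑ aₙ z^(-n-1)` (each `Y(a, z)`
being a field in the sense of Mathlib's `VertexOperator`, i.e. `Y(a, z) b ∈ V((z))`) and a vacuum,
subject to the vacuum, creation and Borcherds (Jacobi) identities. -/
structure VertexAlgebra (V : Type*) [AddCommGroup V] [Module ℂ V] where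
  /-- The state-field correspondence. -/
  Y : V →ₗ[ℂ] VertexOperator ℂ V
  /-- The vacuum vector. -/
  vac : V
  /-- `Y(𝟏, z) = id`. -/
  vac_ncoeff : ∀ (n : ℤ) (b : V), VertexOperator.ncoeff (Y vac) n b = if n = -1 then b else 0
  /-- `Y(a, z) 𝟏` has no negative powers of `z`. -/
  ncoeff_vac : ∀ (a : V) (n : ℤ), 0 ≤ n → VertexOperator.ncoeff (Y a) n vac = 0
  /-- `a₋₁ 𝟏 = a`. -/
  ncoeff_neg_one_vac : ∀ a : V, VertexOperator.ncoeff (Y a) (-1) vac = a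
  /-- The Borcherds identity, which is the Jacobi identity written in modes; all the sums have only
  finitely many nonzero terms. -/
  borcherds : ∀ (a b c : V) (p q r : ℤ),
    ∑ᶠ i : ℕ, Ring.choose p i •
        VertexOperator.ncoeff (Y (VertexOperator.ncoeff (Y a) (r + i) b)) (p + q - i) c =
      ∑ᶠ i : ℕ, ((-1) ^ i * Ring.choose r i) •
        (VertexOperator.ncoeff (Y a) (p + r - i) (VertexOperator.ncoeff (Y b) (q + i) c) -
          (r.negOnePow : ℤ) •
            VertexOperator.ncoeff (Y b) (q + r - i) (VertexOperator.ncoeff (Y a) (p + i) c))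

namespace VertexAlgebra

variable {V : Type*} [AddCommGroup V] [Module ℂ V]

/-- The mode `aₙ` of `Y(a, z) = ∑ aₙ z^(-n-1)`, as a linear function of `a`. -/
def mode (A : VertexAlgebra V) (n : ℤ) : V →ₗ[ℂ] Module.End ℂ V :=
  (LinearMap.proj n ∘ₗ VertexOperator.ncoeff) ∘ₗ A.Y

lemma mode_commutator (A : VertexAlgebra V) (a b c : V) (p q : ℤ) :
    A.mode p a (A.mode q b c) - A.mode q b (A.mode p a c) =
      ∑ᶠ i : ℕ, Ring.choose p i • A.mode (p + q - i) (A.mode i a b) c := by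
  have h := A.borcherds a b c p q 0
  rw [finsum_eq_single (fun i : ℕ => ((-1) ^ i * Ring.choose (0 : ℤ) i) • _) 0] at h
  · simpa [mode] using h.symm
  · intro i hi
    simp [Ring.choose_zero_pos ℤ (Nat.pos_of_ne_zero hi)]

end VertexAlgebra

/-- A vertex operator algebra over `ℂ`: a vertex algebra with a conformal vector `ω`,
`Y(ω, z) = ∑ Lₙ z^(-n-2)`, generating a Virasoro algebra of central charge `C`, such that
`Y(L₋₁ a, z) = ∂ Y(a, z)` and `V = ⨁_{n ≥ 0} Vₙ` with `Vₙ` the finite-dimensional `n`-eigenspace of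
`L₀` and `V₀ = ℂ 𝟏`. (A sum of eigenspaces for different eigenvalues is automatically direct.) -/
structure VertexOperatorAlgebra (V : Type*) [AddCommGroup V] [Module ℂ V] extends
    VertexAlgebra V where
  /-- The conformal vector. -/
  conformal : V
  /-- The central charge `C`. -/
  centralCharge : ℂ
  virasoro : ∀ (m n : ℤ) (v : V),
    toVertexAlgebra.mode (m + 1) conformal (toVertexAlgebra.mode (n + 1) conformal v) -
        toVertexAlgebra.mode (n + 1) conformal (toVertexAlgebra.mode (m + 1) conformal v) =
      ((m : ℂ) - n) • toVertexAlgebra.mode (m + n + 1) conformal v +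
        (if m + n = 0 then ((m : ℂ) ^ 3 - m) / 12 * centralCharge else 0) • v
  translation : ∀ (a : V) (n : ℤ),
    toVertexAlgebra.mode n (toVertexAlgebra.mode 0 conformal a) =
      -(n : ℂ) • toVertexAlgebra.mode (n - 1) a
  iSup_eigenspace : ⨆ n : ℕ, End.eigenspace (toVertexAlgebra.mode 1 conformal) (n : ℂ) = ⊤
  finite_eigenspace : ∀ n : ℕ,
    FiniteDimensional ℂ (End.eigenspace (toVertexAlgebra.mode 1 conformal) (n : ℂ))
  eigenspace_zero : End.eigenspace (toVertexAlgebra.mode 1 conformal) 0 = ℂ ∙ vac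
  vac_ne_zero : vac ≠ 0

namespace VertexOperatorAlgebra

variable {V : Type*} [AddCommGroup V] [Module ℂ V] (A : VertexOperatorAlgebra V)

/-- The Virasoro operator `Lₙ = ωₙ₊₁`. -/
def L (n : ℤ) : Module.End ℂ V := A.mode (n + 1) A.conformal

/-- The space `Vₙ` of vectors of conformal weight `n`. -/
def weightSpace (n : ℕ) : Submodule ℂ V := End.eigenspace (A.L 0) (n : ℂ)

instance (n : ℕ) : FiniteDimensional ℂ (A.weightSpace n) := A.finite_eigenspace n

lemma L_zero_mode {a b : V} {k m : ℂ} (ha : A.L 0 a = k • a) (hb : A.L 0 b = m • b) (n : ℤ) :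
    A.L 0 (A.mode n a b) = (k + m - n - 1) • A.mode n a b := by
  have h := A.mode_commutator A.conformal a b 1 n
  rw [finsum_eq_sum_of_support_subset (s := Finset.range 2)] at h
  · have e1 : A.mode 1 A.conformal a = k • a := by simpa [L] using ha
    have e2 : A.mode 1 A.conformal b = m • b := by simpa [L] using hb
    have e3 : A.L 0 (A.mode n a b) = A.mode 1 A.conformal (A.mode n a b) := by simp [L]
    have e4 : (1 : ℤ) + n - 1 = n := by ring
    simp only [Finset.sum_range_succ, Finset.sum_range_zero, Ring.choose_zero_right,
      Ring.choose_one_right, Nat.cast_zero, Nat.cast_one, A.translation, e1, e2, map_smul,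
      LinearMap.smul_apply, zero_add, one_smul, sub_zero, e4] at h
    rw [e3, sub_eq_iff_eq_add.mp h]
    push_cast
    module
  · intro i hi
    simp only [Function.mem_support] at hi
    by_contra hc
    apply hi
    have h2 : 1 < i := by simpa using hc
    have : Ring.choose (1 : ℤ) i = 0 := by
      have := Ring.choose_natCast (R := ℤ) 1 i
      rw [Nat.choose_eq_zero_of_lt h2] at this
      simpa using this
    simp [this]

lemma eq_zero_of_L_zero {v : V} {k : ℂ} (hv : A.L 0 v = k • v) (hk : ∀ n : ℕ, k ≠ n) : v = 0 := by
  have h := End.eigenspaces_iSupIndep (A.L 0) k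
  have h2 : (⨆ j, ⨆ (_ : j ≠ k), End.eigenspace (A.L 0) j) = ⊤ := by
    rw [eq_top_iff]
    refine le_trans (le_of_eq A.iSup_eigenspace.symm) (iSup_le fun n => ?_)
    have e : A.L 0 = A.mode 1 A.conformal := by simp [L]
    rw [← e]
    exact le_iSup₂_of_le (n : ℂ) (hk n).symm le_rfl
  rw [h2, disjoint_top] at h
  have : v ∈ End.eigenspace (A.L 0) k := End.mem_eigenspace_iff.mpr hv
  simpa [h] using this

lemma L_zero_of_mem {a : V} (ha : a ∈ A.weightSpace 1) : A.L 0 a = (1 : ℂ) • a := by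
  simpa using End.mem_eigenspace_iff.mp ha

lemma mode_zero_mem {a b : V} (ha : a ∈ A.weightSpace 1) (hb : b ∈ A.weightSpace 1) :
    A.mode 0 a b ∈ A.weightSpace 1 := by
  have := A.L_zero_mode (A.L_zero_of_mem ha) (A.L_zero_of_mem hb) 0
  rw [weightSpace, End.mem_eigenspace_iff, this]
  norm_num

lemma mode_zero_skew {a b : V} (ha : a ∈ A.weightSpace 1) (hb : b ∈ A.weightSpace 1) :
    A.mode 0 b a = -A.mode 0 a b := by
  have h := A.mode_commutator a b A.vac (-1) 0
  have hw (n : ℤ) := A.L_zero_mode (A.L_zero_of_mem ha) (A.L_zero_of_mem hb) n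
  rw [finsum_eq_single _ 0] at h
  · have h1 : A.mode 0 b A.vac = 0 := A.ncoeff_vac b 0 le_rfl
    have h2 : A.mode (-1) a A.vac = a := A.ncoeff_neg_one_vac a
    have h3 : A.mode (-1) (A.mode 0 a b) A.vac = A.mode 0 a b := A.ncoeff_neg_one_vac _
    simp only [h1, h2, map_zero, zero_sub, Ring.choose_zero_right, Nat.cast_zero, sub_zero,
      add_zero, h3, one_smul] at h
    rw [← h, neg_neg]
  · intro i hi
    obtain rfl | hi2 : i = 1 ∨ 2 ≤ i := by omega
    · have h0 : A.mode 1 a b ∈ End.eigenspace (A.mode 1 A.conformal) (0 : ℂ) := by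
        rw [End.mem_eigenspace_iff]
        have := hw 1
        simp only [L, zero_add] at this
        rw [this]
        norm_num
      rw [A.eigenspace_zero, Submodule.mem_span_singleton] at h0
      obtain ⟨t, ht⟩ := h0
      have h1 : A.mode (-2) A.vac A.vac = 0 := by
        simpa [VertexAlgebra.mode] using A.vac_ncoeff (-2) A.vac
      simp [← ht, h1]
    · have : A.mode i a b = 0 := by
        refine A.eq_zero_of_L_zero (hw i) fun n hn => ?_
        have h5 : ((2 : ℕ) : ℂ) = ((n + i + 1 : ℕ) : ℂ) := by
          push_cast at hn ⊢
          linear_combination hn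
        have h6 := Nat.cast_injective (R := ℂ) h5
        omega
      simp [this]

/-- The bracket `[a, b] = a₀ b` makes `V₁` a Lie algebra. -/
instance : LieRing (A.weightSpace 1) where
  bracket a b := ⟨A.mode 0 (a : V) b, A.mode_zero_mem a.2 b.2⟩
  add_lie a b c := by ext; simp
  lie_add a b c := by ext; simp
  lie_self a := by
    ext
    have h := A.mode_zero_skew a.2 a.2
    have h2 : (2 : ℂ) • A.mode 0 (a : V) a = 0 := by
      rw [two_smul]
      nth_rewrite 1 [h]
      simp
    simpa [Bracket.bracket] using h2
  leibniz_lie a b c := by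
    ext
    have h := A.mode_commutator (a : V) b c 0 0
    rw [finsum_eq_single _ 0] at h
    · simp only [Ring.choose_zero_right, Nat.cast_zero, sub_zero, add_zero, one_smul] at h
      simpa [Bracket.bracket] using sub_eq_iff_eq_add.mp h
    · intro i hi
      simp [Ring.choose_zero_pos ℤ (Nat.pos_of_ne_zero hi)]

instance : LieAlgebra ℂ (A.weightSpace 1) where
  lie_smul t a b := by ext; simp [Bracket.bracket]

/-- The Lie algebra `𝔤 = V₁`. -/
abbrev lieAlgebra : Type _ := A.weightSpace 1

/-- The space `Vₙ(C, 0)` of weight `n` Virasoro descendants of the vacuum, spanned by the vectors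
`L₋ₙ₁ L₋ₙ₂ ⋯ L₋ₙₖ 𝟏` with all `nᵢ ≥ 1` and `n₁ + ⋯ + nₖ = n`. -/
def vacuumDescendants (n : ℕ) : Submodule ℂ V :=
  Submodule.span ℂ {v | ∃ l : List ℕ, (∀ i ∈ l, 1 ≤ i) ∧ l.sum = n ∧
    v = l.foldr (fun i w => A.L (-(i : ℤ)) w) A.vac}

/-- A Li-Zamolodchikov metric: a symmetric nondegenerate bilinear form on `V` with `⟨𝟏, 𝟏⟩ = 1` and
`⟨Y(e^{z L₁} (-z⁻²)^{L₀} c, z⁻¹) a, b⟩ = ⟨a, Y(c, z) b⟩`. For `c ∈ Vₖ` the left-hand side is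
`(-1)ᵏ ∑ⱼ ∑ₙ (1 / j!) ⟨(L₁ʲ c)ₙ a, b⟩ z^(j - 2k + n + 1)`, where `L₁ʲ c = 0` for `j > k`; the field
`invariant` compares the coefficients of `z^(-m-1)`. -/
structure IsLiZMetric (B : LinearMap.BilinForm ℂ V) : Prop where
  symm : B.IsSymm
  nondegenerate : B.Nondegenerate
  vac_vac : B A.vac A.vac = 1
  invariant : ∀ (k : ℕ), ∀ c ∈ A.weightSpace k, ∀ (a b : V) (m : ℤ),
    (-1) ^ k * ∑ j ∈ Finset.range (k + 1),
        (1 / (j.factorial : ℂ)) * B (A.mode (2 * k - j - m - 2) ((A.L 1 ^ j) c) a) b =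
      B a (A.mode m c b)

/-- The quadratic Casimir vector `λ⁽ⁿ⁾ = ∑_α u^α_{1-n} u_α` for a basis `u_α` of `V₁` and its dual
basis `u^α`. -/
def casimir {ι : Type*} [Fintype ι] (u u' : ι → A.lieAlgebra) (n : ℕ) : V :=
  ∑ i, A.mode (1 - n) (u' i : V) (u i : V)

end VertexOperatorAlgebra

section RootData

variable {L : Type*} [LieRing L] [LieAlgebra ℂ L] [FiniteDimensional ℂ L] [LieAlgebra.IsKilling ℂ L]

/-- A root is long if its length is maximal. Lengths are measured by the canonical
Weyl-invariant form `(x, y) = ∑_β ⟨x, β^∨⟩ ⟨y, β^∨⟩`. -/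
def IsLongRoot {H : LieSubalgebra ℂ L} [H.IsCartanSubalgebra] (α : H.root) : Prop :=
  ∀ β : H.root, ((LieAlgebra.IsKilling.rootSystem H).posRootForm ℤ).rootLength β ≤
    ((LieAlgebra.IsKilling.rootSystem H).posRootForm ℤ).rootLength α

/-- `θ` is the highest root with respect to the base `b`: for every root `β`, the difference
`θ - β` is a sum of simple roots. -/
def IsHighestRoot {H : LieSubalgebra ℂ L} [H.IsCartanSubalgebra]
    (b : (LieAlgebra.IsKilling.rootSystem H).Base) (θ : H.root) : Prop :=
  ∀ β : H.root, (LieAlgebra.IsKilling.rootSystem H).root θ -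
      (LieAlgebra.IsKilling.rootSystem H).root β ∈
    AddSubmonoid.closure ((LieAlgebra.IsKilling.rootSystem H).root '' b.support)

/-- `h` is the dual Coxeter number of the simple Lie algebra `L` with Cartan subalgebra `H`: it is
`1` plus the sum of the coefficients of `θ^∨` in the basis of simple coroots, where `θ` is the
highest root with respect to a base. -/
def IsDualCoxeterNumber (H : LieSubalgebra ℂ L) [H.IsCartanSubalgebra] (h : ℤ) : Prop :=
  ∃ (b : (LieAlgebra.IsKilling.rootSystem H).Base) (θ : H.root),
    IsHighestRoot b θ ∧ h = 1 + b.flip.height θ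

/-- The standard invariant form on a simple Lie algebra: symmetric, invariant, and such that long
roots have squared length `2`, i.e. `(α^∨, α^∨) = 4 / (α, α) = 2` for the coroot `α^∨` of every
long root `α`. -/
structure IsNormalizedForm (H : LieSubalgebra ℂ L) [H.IsCartanSubalgebra]
    (φ : LinearMap.BilinForm ℂ L) : Prop where
  symm : φ.IsSymm
  invariant : ∀ x y z : L, φ ⁅x, y⁆ z = φ x ⁅y, z⁆
  long : ∀ α : H.root, IsLongRoot α →
    φ (LieAlgebra.IsKilling.coroot (α : LieModule.Weight ℂ H L))
      (LieAlgebra.IsKilling.coroot (α : LieModule.Weight ℂ H L)) = 2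

end RootData

namespace VertexOperatorAlgebra

variable {V : Type*} [AddCommGroup V] [Module ℂ V] (A : VertexOperatorAlgebra V)
  {I : LieIdeal ℂ A.lieAlgebra} [LieAlgebra.IsKilling ℂ I]
  (H : LieSubalgebra ℂ I) [H.IsCartanSubalgebra]

/-- The modes of the simple ideal `I` of `𝔤 = V₁` form an affine Kac-Moody algebra of level `k`:
`[aₘ, bₙ] = [a, b]ₘ₊ₙ + m k (a, b) δ_{m+n,0}` with the standard form `(·, ·)` on `I`. -/
def HasKacMoodyLevel (k : ℂ) : Prop :=
  ∃ φ : LinearMap.BilinForm ℂ I, IsNormalizedForm H φ ∧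
    ∀ (a b : I) (m n : ℤ) (v : V),
      A.mode m ((a : A.lieAlgebra) : V) (A.mode n ((b : A.lieAlgebra) : V) v) -
          A.mode n ((b : A.lieAlgebra) : V) (A.mode m ((a : A.lieAlgebra) : V) v) =
        A.mode (m + n) ((⁅a, b⁆ : I) : A.lieAlgebra) v +
          (if m + n = 0 then (m : ℂ) * k * φ a b else 0) • v

/-- The number `-⟨α, α⟩ / 2` attached to a long root `α` of the simple ideal `I`. Here `α` is
regarded as an element of `H` through the standard form, in which `(α, α) = 2`; this element is the
coroot `α^∨`. -/
def rootLevel (B : LinearMap.BilinForm ℂ V) (α : H.root) : ℂ :=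
  -(1 / 2) * B (((LieAlgebra.IsKilling.coroot (α : LieModule.Weight ℂ H I) : I) : A.lieAlgebra) : V)
    (((LieAlgebra.IsKilling.coroot (α : LieModule.Weight ℂ H I) : I) : A.lieAlgebra) : V)

end VertexOperatorAlgebra

end

/-! Weights are nonnegative and V₀ = ℂ𝟏, so for a, b in V₁ invariance of the metric gives L₁a = 0,
a₁b = -⟨a,b⟩𝟏 and aₙb = 0 for n ≥ 2. The modes of V₁ therefore satisfy affine relations with central
term -m⟨a,b⟩.

Since L₋₁𝟏 = 0, V₂(C,0) = ℂω. Comparing L₂ω = (C/2)𝟏 with L₂λ⁽²⁾ = -d₁𝟏 gives λ⁽²⁾ = -(2d₁/C)ω.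
Evaluating ⟨a, λ⁽²⁾₁ b⟩ through ω₁ = L₀, and again through the Borcherds identity, where it equals
-2⟨a,b⟩ + K(a,b), yields the formula for K (`killingForm_eq`). If d₁ = C then K = 0 and Cartan's
criterion applies; otherwise K is a nonzero multiple of a nondegenerate form.

The levels rest on two facts about an irreducible root system: all long roots have coroots of the
same Killing length (`rootForm_mul_corootForm_eq`), and that length is 4h^∨
(`corootForm_coroot_self_of_forall_sub_mem_closure`). Since K(α^∨,α^∨) is also 4k(d₁/C - 1), this
gives h^∨. -/

noncomputable section

/-! ### Root systems: canonical forms, the highest root and the dual Coxeter number. -/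

namespace RootPairing

variable {ι K M N : Type*} [Field K] [CharZero K] [AddCommGroup M] [Module K M]
  [AddCommGroup N] [Module K N] {P : RootPairing ι K M N}

section Proportional

variable [Fintype ι]

omit [CharZero K] in
lemma rootForm_coPolarization_polarization (P : RootPairing ι K M N) (x y : M) :
    P.RootForm x (P.CoPolarization (P.Polarization y)) =
      P.RootForm y (P.CoPolarization (P.Polarization x)) := by
  rw [← P.toLinearMap_apply_apply_Polarization, ← P.toLinearMap_apply_apply_Polarization,
    P.toLinearMap_apply_CoPolarization, P.toLinearMap_apply_CoPolarization]
  exact (P.flip.rootForm_symmetric.eq _ _).symm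

/-- The products are the eigenvalues on the roots of an operator T that is self-adjoint for the root
form. If x has eigenvalue `c i`, then each root k is either orthogonal to x, so that its reflection
fixes x, or has `c k = c i`. The eigenspace is thus stable under reflections, and irreducibility
makes it everything. Consequently roots of equal length have coroots of equal length. -/
lemma rootForm_mul_corootForm_eq [P.IsCrystallographic] [P.IsIrreducible] (i j : ι) :
    P.RootForm (P.root i) (P.root i) * P.CorootForm (P.coroot i) (P.coroot i) =
      P.RootForm (P.root j) (P.root j) * P.CorootForm (P.coroot j) (P.coroot j) := by
  set T : Module.End K M := 4 • P.CoPolarization ∘ₗ P.Polarization with hT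
  set c : ι → K := fun k ↦
    P.RootForm (P.root k) (P.root k) * P.CorootForm (P.coroot k) (P.coroot k) with hc
  have hTc (k : ι) : T (P.root k) = c k • P.root k :=
    P.four_nsmul_coPolarization_compl_polarization_apply_root k
  have hsymm (x y : M) : P.RootForm x (T y) = P.RootForm y (T x) := by
    rw [hT, LinearMap.smul_apply, LinearMap.smul_apply, map_nsmul, map_nsmul]
    exact congr_arg (4 • ·) (P.rootForm_coPolarization_polarization x y)
  have hker (k : ι) (x : M) (h : P.RootForm (P.root k) x = 0) : P.coroot' k x = 0 := by
    have h1 := congr_arg (P.toLinearMap x) (P.rootForm_self_smul_coroot k)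
    rw [map_smul, map_nsmul, P.toLinearMap_apply_apply_Polarization, h] at h1
    have h2 : P.RootForm (P.root k) (P.root k) ≠ 0 := (P.posRootForm ℤ).form_apply_root_ne_zero k
    rw [smul_zero, smul_eq_mul] at h1
    exact (mul_eq_zero.mp h1).resolve_left h2
  have htop : End.eigenspace T (c i) = ⊤ := by
    refine IsIrreducible.eq_top_of_invtSubmodule_reflection (P := P) _ (fun k x hx ↦ ?_) ?_
    · rw [Submodule.mem_comap]
      change P.reflection k x ∈ _
      rw [P.reflection_apply]
      refine sub_mem hx ?_
      by_cases h : P.RootForm (P.root k) x = 0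
      · rw [hker k x h, zero_smul]
        exact zero_mem _
      · refine Submodule.smul_mem _ _ ?_
        have h1 := hsymm (P.root k) x
        rw [End.mem_eigenspace_iff.mp hx, hTc, map_smul, map_smul,
          show P.RootForm x (P.root k) = P.RootForm (P.root k) x from
            (P.rootForm_symmetric.eq (P.root k) x).symm] at h1
        rw [End.mem_eigenspace_iff, hTc, mul_right_cancel₀ h h1]
    · refine Submodule.ne_bot_iff _ |>.mpr ⟨P.root i, ?_, P.ne_zero i⟩
      exact End.mem_eigenspace_iff.mpr (hTc i)
  have hj : P.root j ∈ End.eigenspace T (c i) := htop ▸ Submodule.mem_top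
  rw [End.mem_eigenspace_iff, hTc] at hj
  exact (smul_left_injective K (P.ne_zero j) hj).symm

end Proportional

namespace Base

variable (b : P.Base)

omit [CharZero K] in
lemma exists_nat_of_mem_closure {x : M} (hx : x ∈ AddSubmonoid.closure (P.root '' b.support)) :
    ∃ f : ι → ℕ, x = ∑ j ∈ b.support, f j • P.root j := by
  classical
  induction hx using AddSubmonoid.closure_induction with
  | mem x hx =>
    obtain ⟨i, hi, rfl⟩ := hx
    refine ⟨Pi.single i 1, ?_⟩
    rw [Finset.sum_eq_single_of_mem i hi (fun j _ hj ↦ by simp [hj])]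
    simp
  | zero => exact ⟨0, by simp⟩
  | add x y _ _ hx hy =>
    obtain ⟨f, rfl⟩ := hx
    obtain ⟨g, rfl⟩ := hy
    exact ⟨f + g, by simp [add_smul, Finset.sum_add_distrib]⟩

lemma height_le_of_sub_mem_closure {i j : ι}
    (h : P.root i - P.root j ∈ AddSubmonoid.closure (P.root '' b.support)) :
    b.height j ≤ b.height i := by
  obtain ⟨f, hf⟩ := b.exists_nat_of_mem_closure h
  obtain ⟨g, -, -, hg⟩ := b.exists_root_eq_sum_int j
  have hi : P.root i = ∑ k ∈ b.support, (g k + f k) • P.root k := by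
    rw [sub_eq_iff_eq_add'.mp hf, hg, ← Finset.sum_add_distrib]
    exact Finset.sum_congr rfl fun k _ ↦ by rw [add_smul, natCast_zsmul]
  rw [height_eq_sum hg, height_eq_sum hi, Finset.sum_add_distrib]
  have : 0 ≤ ∑ k ∈ b.support, (f k : ℤ) := Finset.sum_nonneg fun k _ ↦ by positivity
  lia

variable [P.IsCrystallographic]

lemma height_reflectionPerm {i j : ι} (hj : j ∈ b.support) :
    b.height (P.reflectionPerm j i) = b.height i - P.pairingIn ℤ i j := by
  have h : P.root (P.reflectionPerm j i) = P.root i + (-P.pairingIn ℤ i j) • P.root j := by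
    rw [root_reflectionPerm, neg_smul, reflection_apply_root' ℤ, sub_eq_add_neg]
  rw [b.height_add_zsmul h, height_one_of_mem_support hj]
  simp [sub_eq_add_neg]

/-- Pairing with a fixed coroot is additive along an expansion in simple roots. -/
lemma pairingIn_eq_sum {i : ι} {f : ι → ℤ} (hf : P.root i = ∑ j ∈ b.support, f j • P.root j)
    (k : ι) : P.pairingIn ℤ i k = ∑ j ∈ b.support, f j * P.pairingIn ℤ j k := by
  apply FaithfulSMul.algebraMap_injective ℤ K
  simp_rw [map_sum, map_mul, algebraMap_pairingIn, ← root_coroot_eq_pairing, hf, map_sum, map_zsmul,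
    LinearMap.coe_sum, Finset.sum_apply, LinearMap.smul_apply, zsmul_eq_mul, eq_intCast]

omit [P.IsCrystallographic] in
lemma IsPos.exists_nat {b : P.Base} {i : ι} (hi : b.IsPos i) :
    ∃ f : ι → ℕ, P.root i = ∑ j ∈ b.support, f j • P.root j := by
  obtain ⟨f, -, hf | hf⟩ := b.exists_root_eq_sum_nat_or_neg i
  · exact ⟨f, hf⟩
  · have : P.root i = ∑ j ∈ b.support, (-(f j : ℤ)) • P.root j := by
      simp [hf, neg_smul, Finset.sum_neg_distrib]
    rw [isPos_iff, height_eq_sum this, Finset.sum_neg_distrib] at hi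
    have : 0 ≤ ∑ k ∈ b.support, (f k : ℤ) := Finset.sum_nonneg fun k _ ↦ by positivity
    lia

/-- A root is dominant if it pairs non-negatively with the simple coroots. -/
def IsDominant (i : ι) : Prop := ∀ j ∈ b.support, 0 ≤ P.pairingIn ℤ i j

variable {b} [Finite ι]

lemma IsDominant.pairingIn_nonneg {i j : ι} (hi : b.IsDominant i) (hj : j ∈ b.support) :
    0 ≤ P.pairingIn ℤ j i := by
  have h := hi j hj
  contrapose! h
  exact (P.pairingIn_lt_zero_iff ℤ).mp h

lemma IsDominant.pairingIn_nonneg_of_isPos {i j : ι} (hi : b.IsDominant i) (hj : b.IsPos j) :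
    0 ≤ P.pairingIn ℤ j i := by
  obtain ⟨f, hf⟩ := hj.exists_nat
  rw [b.pairingIn_eq_sum (f := fun k ↦ (f k : ℤ)) (by simpa using hf)]
  exact Finset.sum_nonneg fun k hk ↦ mul_nonneg (by positivity) (hi.pairingIn_nonneg hk)

lemma IsDominant.pairingIn_le_of_sub_mem_closure {i j k : ι} (hk : b.IsDominant k)
    (h : P.root i - P.root j ∈ AddSubmonoid.closure (P.root '' b.support)) :
    P.pairingIn ℤ j k ≤ P.pairingIn ℤ i k := by
  obtain ⟨f, hf⟩ := b.exists_nat_of_mem_closure h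
  obtain ⟨g, -, -, hg⟩ := b.exists_root_eq_sum_int j
  have hi : P.root i = ∑ k ∈ b.support, (g k + f k) • P.root k := by
    rw [sub_eq_iff_eq_add'.mp hf, hg, ← Finset.sum_add_distrib]
    exact Finset.sum_congr rfl fun k _ ↦ by rw [add_smul, natCast_zsmul]
  rw [b.pairingIn_eq_sum hg, b.pairingIn_eq_sum hi]
  refine Finset.sum_le_sum fun l hl ↦ ?_
  have := mul_nonneg (Int.natCast_nonneg (f l)) (hk.pairingIn_nonneg hl)
  linarith

-- Reflecting θ in a simple root cannot raise its height, and the change of height is minus the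
-- pairing.
omit [Finite ι] in
lemma isDominant_of_forall_sub_mem_closure {θ : ι}
    (hθ : ∀ i, P.root θ - P.root i ∈ AddSubmonoid.closure (P.root '' b.support)) :
    b.IsDominant θ := by
  intro j hj
  have h := b.height_le_of_sub_mem_closure (hθ (P.reflectionPerm j θ))
  rw [b.height_reflectionPerm hj] at h
  lia

omit [P.IsCrystallographic] [Finite ι] in
lemma isPos_of_forall_sub_mem_closure {θ : ι}
    (hθ : ∀ i, P.root θ - P.root i ∈ AddSubmonoid.closure (P.root '' b.support)) :
    b.IsPos θ := by
  have h := b.height_le_of_sub_mem_closure (hθ (P.reflectionPerm θ θ))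
  have h2 : b.height (P.reflectionPerm θ θ) = -b.height θ := b.height_reflectionPerm_self θ
  rw [isPos_iff']
  lia

omit [Finite ι] in
lemma rootLength_reflectionPerm (B : P.RootPositiveForm ℤ) (i j : ι) :
    B.rootLength (P.reflectionPerm j i) = B.rootLength i := by
  apply FaithfulSMul.algebraMap_injective ℤ K
  rw [B.algebraMap_rootLength, B.algebraMap_rootLength, root_reflectionPerm]
  exact B.isOrthogonal_reflection j _ _

lemma rootLength_le_of_forall_sub_mem_closure (B : P.RootPositiveForm ℤ) {θ : ι}
    (hθ : ∀ i, P.root θ - P.root i ∈ AddSubmonoid.closure (P.root '' b.support)) (i : ι) :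
    B.rootLength i ≤ B.rootLength θ := by
  have hd := isDominant_of_forall_sub_mem_closure hθ
  -- Among the roots as long as i, one of maximal height is dominant, because simple reflections
  -- preserve length.
  obtain ⟨k, hk, hmax⟩ := Set.exists_max_image {k | B.rootLength k = B.rootLength i} b.height
    (Set.toFinite _) ⟨i, rfl⟩
  have hkd : b.IsDominant k := by
    intro j hj
    have h := hmax (P.reflectionPerm j k) ((rootLength_reflectionPerm B k j).trans hk)
    rw [b.height_reflectionPerm hj] at h
    lia
  -- Pairing θ - k with k^∨ and with θ^∨ gives ⟨θ,k^∨⟩ ≥ 2 and ⟨k,θ^∨⟩ ≤ 2; the ratio of these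
  -- pairings is the ratio of the lengths.
  have h1 := hkd.pairingIn_le_of_sub_mem_closure (hθ k)
  have h2 := hd.pairingIn_le_of_sub_mem_closure (hθ k)
  rw [pairingIn_same] at h1 h2
  have h3 := B.pairingIn_mul_eq_pairingIn_mul_swap θ k
  have h5 := B.rootLength_pos θ
  have h6 := B.rootLength_pos k
  rw [← show B.rootLength k = B.rootLength i from hk]
  nlinarith

variable [P.IsReduced]

-- This is ⟨2ρ, αᵢ^∨⟩ = 2. The simple reflection permutes the positive roots other than αᵢ and
-- negates their pairing with αᵢ^∨, so only αᵢ itself contributes.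
open Classical in
lemma sum_isPos_pairingIn_simple [Fintype ι] {i : ι} (hi : i ∈ b.support) :
    ∑ j with b.IsPos j, P.pairingIn ℤ j i = 2 := by
  have hmem : i ∈ Finset.univ.filter b.IsPos := by simpa using isPos_of_mem_support hi
  rw [← Finset.add_sum_erase _ _ hmem, pairingIn_same, add_eq_left]
  have h : ∑ j ∈ (Finset.univ.filter b.IsPos).erase i, P.pairingIn ℤ j i =
      ∑ j ∈ (Finset.univ.filter b.IsPos).erase i, -P.pairingIn ℤ j i := by
    refine Finset.sum_bij' (fun j _ ↦ P.reflectionPerm i j) (fun j _ ↦ P.reflectionPerm i j)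
      ?_ ?_ (by simp) (by simp) ?_
    rotate_left 2
    · intro j _
      rw [← P.pairingIn_reflectionPerm, pairingIn_reflectionPerm_self_right, neg_neg]
    all_goals
      intro j hj
      simp only [Finset.mem_erase, Finset.mem_filter_univ] at hj ⊢
      refine ⟨fun h ↦ ?_, hj.2.reflectionPerm hi hj.1⟩
      have h1 : b.height (P.reflectionPerm i i) = -b.height i := b.height_reflectionPerm_self i
      have h2 : P.reflectionPerm i i = j := by
        rw [← P.reflectionPerm_self i j, h]
      rw [h2, height_one_of_mem_support hi] at h1
      have := b.isPos_iff.mp hj.2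
      lia
  rw [Finset.sum_neg_distrib] at h
  lia

open Classical in
lemma sum_isPos_pairingIn [Fintype ι] (i : ι) :
    ∑ j with b.IsPos j, P.pairingIn ℤ j i = 2 * b.flip.height i := by
  obtain ⟨g, -, -, hg⟩ := b.flip.exists_root_eq_sum_int i
  have h (j : ι) : P.pairingIn ℤ j i = ∑ k ∈ b.support, g k * P.pairingIn ℤ j k := by
    apply FaithfulSMul.algebraMap_injective ℤ K
    replace hg : P.coroot i = ∑ j ∈ b.support, g j • P.coroot j := hg
    simp_rw [map_sum, map_mul, algebraMap_pairingIn, ← root_coroot_eq_pairing, hg, map_sum,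
      map_zsmul, zsmul_eq_mul, eq_intCast]
  rw [height_eq_sum hg, Finset.mul_sum, Finset.sum_congr rfl fun j _ ↦ h j, Finset.sum_comm]
  refine Finset.sum_congr rfl fun k hk ↦ ?_
  rw [← Finset.mul_sum, sum_isPos_pairingIn_simple (b := b) hk, mul_comm]

/-- For the highest root `θ`, the canonical form takes the value `4 h^∨` at `θ^∨`. -/
lemma corootForm_coroot_self_of_forall_sub_mem_closure [Fintype ι] {θ : ι}
    (hθ : ∀ i, P.root θ - P.root i ∈ AddSubmonoid.closure (P.root '' b.support)) :
    P.CorootForm (P.coroot θ) (P.coroot θ) = 4 * ((1 + b.flip.height θ : ℤ) : K) := by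
  classical
  let _i := P.indexNeg
  have hd := isDominant_of_forall_sub_mem_closure hθ
  have hp := isPos_of_forall_sub_mem_closure hθ
  set p : ι → ℤ := fun j ↦ P.pairingIn ℤ j θ with hpdef
  have h1 : P.CorootForm (P.coroot θ) (P.coroot θ) = ((∑ j, p j ^ 2 : ℤ) : K) := by
    rw [corootForm_apply_apply]
    push_cast
    refine Finset.sum_congr rfl fun j _ ↦ ?_
    rw [hpdef, ← eq_intCast (algebraMap ℤ K), algebraMap_pairingIn]
    simp [sq]
  -- The value is ∑_β ⟨β,θ^∨⟩² over all roots; negation reduces it to twice the sum over positive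
  -- roots.
  have h2 : ∑ j with ¬ b.IsPos j, p j ^ 2 = ∑ j with b.IsPos j, p j ^ 2 := by
    refine Finset.sum_bij' (fun j _ ↦ -j) (fun j _ ↦ -j) ?_ ?_
      (fun j _ ↦ neg_neg j) (fun j _ ↦ neg_neg j) ?_
    · intro j hj
      rw [Finset.mem_filter_univ] at hj ⊢
      exact (IsPos.neg_iff_not b j).mpr hj
    · intro j hj
      have := IsPos.neg_iff_not b (-j)
      rw [neg_neg] at this
      rw [Finset.mem_filter_univ] at hj ⊢
      exact this.mp hj
    · intro j _
      simp [hpdef]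
  have h3 (j : ι) (hj : b.IsPos j) (hne : j ≠ θ) : p j ^ 2 = p j := by
    have h0 := hd.pairingIn_nonneg_of_isPos hj
    -- A pairing outside {-1, 0, 1} with j ≠ ±θ would make j strictly longer than θ. Dominance then
    -- excludes -1, so the square equals the pairing.
    have hmem : P.pairingIn ℤ j θ ∈ ({-1, 0, 1} : Set ℤ) := by
      by_contra hc
      refine absurd ((P.posRootForm ℤ).rootLength_lt_of_pairingIn_notMem (by simpa) ?_ hc)
        (not_lt.mpr (rootLength_le_of_forall_sub_mem_closure _ hθ j))
      intro h
      have : j = -θ := by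
        apply P.root.injective
        simpa using h
      rw [this, IsPos.neg_iff_not] at hj
      exact hj hp
    simp only [hpdef]
    rcases hmem with h | h | h
    · lia
    · rw [h]; rfl
    · rw [Set.mem_singleton_iff.mp h]; rfl
  -- Only θ differs, contributing 4 rather than 2. The remaining linear sum is ⟨2ρ, θ^∨⟩, twice the
  -- height of θ^∨.
  have h4 : ∑ j with b.IsPos j, p j ^ 2 = 2 + ∑ j with b.IsPos j, p j := by
    have hmem : θ ∈ Finset.univ.filter b.IsPos := by simpa using hp
    rw [← Finset.add_sum_erase _ _ hmem, ← Finset.add_sum_erase _ p hmem]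
    have : p θ = 2 := P.pairingIn_same ℤ θ
    have h5 : ∑ j ∈ (Finset.univ.filter b.IsPos).erase θ, p j ^ 2 =
        ∑ j ∈ (Finset.univ.filter b.IsPos).erase θ, p j := by
      refine Finset.sum_congr rfl fun j hj ↦ ?_
      simp only [Finset.mem_erase, Finset.mem_filter_univ] at hj
      exact h3 j hj.2 hj.1
    rw [this, h5]
    ring
  rw [h1, ← Finset.sum_filter_add_sum_filter_not _ b.IsPos, h2, h4, sum_isPos_pairingIn]
  push_cast
  ring

end Base

end RootPairing

/-! ### Weight-one modes, the metric and the Casimir vector. -/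

namespace VertexOperatorAlgebra

variable {V : Type*} [AddCommGroup V] [Module ℂ V] (A : VertexOperatorAlgebra V)

lemma mode_nonneg_vac (a : V) {n : ℤ} (hn : 0 ≤ n) : A.mode n a A.vac = 0 :=
  A.ncoeff_vac a n hn

lemma mode_neg_one_vac (a : V) : A.mode (-1) a A.vac = a :=
  A.ncoeff_neg_one_vac a

lemma mode_vac (n : ℤ) (b : V) : A.mode n A.vac b = if n = -1 then b else 0 :=
  A.vac_ncoeff n b

lemma L_commutator (m n : ℤ) (v : V) :
    A.L m (A.L n v) - A.L n (A.L m v) = ((m : ℂ) - n) • A.L (m + n) v +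
      (if m + n = 0 then ((m : ℂ) ^ 3 - m) / 12 * A.centralCharge else 0) • v :=
  A.virasoro m n v

lemma L_zero_L {v : V} {k : ℂ} (hv : A.L 0 v = k • v) (m : ℤ) :
    A.L 0 (A.L m v) = (k - m) • A.L m v := by
  have h := A.L_commutator 0 m v
  rw [hv, map_smul, zero_add] at h
  have h2 : (if m = 0 then (((0 : ℤ) : ℂ) ^ 3 - (0 : ℤ)) / 12 * A.centralCharge else 0) = 0 := by
    split <;> simp
  rw [h2, zero_smul, add_zero] at h
  rw [sub_eq_iff_eq_add.mp h]
  push_cast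
  module

lemma L_neg_two_vac : A.L (-2) A.vac = A.conformal :=
  A.mode_neg_one_vac A.conformal

lemma L_vac {n : ℤ} (hn : -1 ≤ n) : A.L n A.vac = 0 :=
  A.mode_nonneg_vac _ (by lia)

lemma L_two_conformal : A.L 2 A.conformal = (A.centralCharge / 2) • A.vac := by
  have h := A.L_commutator 2 (-2) A.vac
  rw [A.L_vac (by lia : (-1 : ℤ) ≤ 2), map_zero, sub_zero, L_neg_two_vac] at h
  rw [h, show (2 : ℤ) + -2 = 0 by rfl, A.L_vac (by lia : (-1 : ℤ) ≤ 0), smul_zero, zero_add,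
    if_pos rfl]
  congr 1
  push_cast
  ring

lemma exists_eq_smul_vac {v : V} (hv : A.L 0 v = 0) : ∃ t : ℂ, v = t • A.vac := by
  have h : v ∈ End.eigenspace (A.mode 1 A.conformal) (0 : ℂ) := by
    rw [End.mem_eigenspace_iff, zero_smul]
    simpa [L] using hv
  rw [A.eigenspace_zero, Submodule.mem_span_singleton] at h
  exact h.imp fun _ ht ↦ ht.symm

section WeightOne

variable {a b : V} (ha : a ∈ A.weightSpace 1) (hb : b ∈ A.weightSpace 1)
include ha

lemma L_eq_zero {m : ℤ} (hm : 2 ≤ m) : A.L m a = 0 := by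
  refine A.eq_zero_of_L_zero (A.L_zero_L (A.L_zero_of_mem ha) m) fun n hn ↦ ?_
  have : (1 : ℤ) - m = n := by exact_mod_cast hn
  lia

include hb

lemma mode_eq_zero {m : ℤ} (hm : 2 ≤ m) : A.mode m a b = 0 := by
  refine A.eq_zero_of_L_zero (A.L_zero_mode (A.L_zero_of_mem ha) (A.L_zero_of_mem hb) m)
    fun n hn ↦ ?_
  have : (1 : ℤ) + 1 - m - 1 = n := by exact_mod_cast hn
  lia

/-- The Borcherds identity for the mode `(a₋₁ b)₁`, applied to a vector of weight one. -/
lemma mode_one_mode_neg_one {c : V} (hc : c ∈ A.weightSpace 1) :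
    A.mode 1 (A.mode (-1) a b) c = A.mode (-1) a (A.mode 1 b c) +
      A.mode 0 b (A.mode 0 a c) + A.mode (-1) b (A.mode 1 a c) := by
  -- With p = 0 the left side is a single term; on the right, i ≥ 2 and the term a₋₂b₂c vanish by
  -- weight.
  have h := A.borcherds a b c 0 1 (-1)
  rw [finsum_eq_single _ 0, finsum_eq_sum_of_support_subset (s := Finset.range 2)] at h
  · have h2 : A.mode (-2) a (A.mode 2 b c) = 0 := by
      rw [A.mode_eq_zero hb hc le_rfl, map_zero]
    simp only [Finset.sum_range_succ, Finset.sum_range_zero, Ring.choose_zero_right,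
      Ring.choose_one_right] at h
    change A.mode 1 (A.mode (-1) a b) c = _
    have h3 : A.mode 1 (A.mode (-1) a b) c = A.mode (-1) a (A.mode 1 b c) +
        A.mode 0 b (A.mode 0 a c) + (A.mode (-2) a (A.mode 2 b c) +
          A.mode (-1) b (A.mode 1 a c)) := by
      simpa [VertexAlgebra.mode] using h
    rw [h3, h2, zero_add]
  · intro i hi
    by_contra hc'
    apply hi
    have hi2 : 1 < i := by simpa using hc'
    have e1 : VertexOperator.ncoeff (A.Y b) (1 + (i : ℤ)) c = 0 := A.mode_eq_zero hb hc (by lia)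
    have e2 : VertexOperator.ncoeff (A.Y a) (0 + (i : ℤ)) c = 0 := A.mode_eq_zero ha hc (by lia)
    simp only [e1, e2, map_zero, smul_zero, sub_zero]
  · intro i hi
    simp [Ring.choose_zero_pos ℤ (Nat.pos_of_ne_zero hi)]

end WeightOne

namespace IsLiZMetric

variable {A} {B : LinearMap.BilinForm ℂ V} (hB : A.IsLiZMetric B)
include hB

/-- By weight L₁c = t𝟏. Invariance for c at a = b = 𝟏, m = 0 reads -t = 0, since c₀𝟏 = 0. -/
lemma L_one_eq_zero {c : V} (hc : c ∈ A.weightSpace 1) : A.L 1 c = 0 := by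
  obtain ⟨t, ht⟩ := A.exists_eq_smul_vac (v := A.L 1 c) (by
    rw [A.L_zero_L (A.L_zero_of_mem hc)]; simp)
  have h := hB.invariant 1 c hc A.vac A.vac 0
  simp [Finset.sum_range_succ, A.mode_nonneg_vac, ht, mode_vac, hB.vac_vac] at h
  rw [ht, h, zero_smul]

lemma apply_mode {c : V} (hc : c ∈ A.weightSpace 1) (a b : V) (m : ℤ) :
    B a (A.mode m c b) = -B (A.mode (-m) c a) b := by
  have h := hB.invariant 1 c hc a b m
  rw [← h]
  simp [Finset.sum_range_succ, hB.L_one_eq_zero hc]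

lemma apply_comm (a b : V) : B a b = B b a :=
  hB.symm.eq a b

lemma mode_one {a b : V} (ha : a ∈ A.weightSpace 1) (hb : b ∈ A.weightSpace 1) :
    A.mode 1 a b = -B a b • A.vac := by
  obtain ⟨t, ht⟩ := A.exists_eq_smul_vac (v := A.mode 1 a b) (by
    rw [A.L_zero_mode (A.L_zero_of_mem ha) (A.L_zero_of_mem hb)]; simp)
  have h := hB.apply_mode ha A.vac b 1
  rw [ht, A.mode_neg_one_vac, map_smul, hB.vac_vac, smul_eq_mul, mul_one] at h
  rw [ht, h]

/-- The affine commutation relations of the modes of vectors of weight one. -/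
lemma mode_commutator {a b : V} (ha : a ∈ A.weightSpace 1) (hb : b ∈ A.weightSpace 1)
    (m n : ℤ) (v : V) :
    A.mode m a (A.mode n b v) - A.mode n b (A.mode m a v) =
      A.mode (m + n) (A.mode 0 a b) v + (if m + n = 0 then -(m : ℂ) * B a b else 0) • v := by
  rw [A.toVertexAlgebra.mode_commutator a b v m n,
    finsum_eq_sum_of_support_subset (s := Finset.range 2)]
  · simp only [Finset.sum_range_succ, Finset.sum_range_zero, Ring.choose_zero_right,
      Ring.choose_one_right, Nat.cast_zero, Nat.cast_one, zero_add, sub_zero, one_smul,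
      hB.mode_one ha hb, map_smul, LinearMap.smul_apply, mode_vac]
    congr 1
    by_cases h : m + n = 0
    · rw [if_pos h, if_pos (by lia), ← Int.cast_smul_eq_zsmul ℂ, smul_smul]
      congr 1
      ring
    · rw [if_neg h, if_neg (by lia)]
      simp
  · intro i hi
    by_contra hc
    apply hi
    have hi2 : 1 < i := by simpa using hc
    simp [A.mode_eq_zero ha hb (by lia : (2 : ℤ) ≤ i)]

/-- In [L₂, a₋₁] only L₋₁a and L₀a contribute, giving -2a₁ + 3a₁ = a₁, while L₂b = 0. -/
lemma L_two_mode_neg_one {a b : V} (ha : a ∈ A.weightSpace 1) (hb : b ∈ A.weightSpace 1) :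
    A.L 2 (A.mode (-1) a b) = -B a b • A.vac := by
  have h := A.toVertexAlgebra.mode_commutator A.conformal a b 3 (-1)
  rw [finsum_eq_sum_of_support_subset (s := Finset.range 4)] at h
  · have e0 : A.mode 2 (A.mode 0 A.conformal a) b = -(2 : ℂ) • A.mode 1 a b := by
      simp [A.translation]
    have e1 : A.mode 1 A.conformal a = a := by simpa [L] using A.L_zero_of_mem ha
    have e2 : A.mode 2 A.conformal a = 0 := hB.L_one_eq_zero ha
    have e3 : A.mode 3 A.conformal a = 0 := A.L_eq_zero ha le_rfl
    have e4 : A.mode 3 A.conformal b = 0 := A.L_eq_zero hb le_rfl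
    simp only [Finset.sum_range_succ, Finset.sum_range_zero, Ring.choose_zero_right,
      Ring.choose_one_right] at h
    have h2 : A.mode 3 A.conformal (A.mode (-1) a b) =
        -(2 : ℂ) • A.mode 1 a b + (3 : ℤ) • A.mode 1 a b := by
      simpa [e0, e1, e2, e3, e4] using h
    change A.mode 3 A.conformal (A.mode (-1) a b) = _
    rw [h2, ← Int.cast_smul_eq_zsmul ℂ, ← add_smul, hB.mode_one ha hb]
    norm_num
  · intro i hi
    by_contra hc
    apply hi
    have h2 : 4 ≤ i := by simpa using hc
    have : Ring.choose (3 : ℤ) i = 0 := by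
      have := Ring.choose_natCast (R := ℤ) 3 i
      rw [Nat.choose_eq_zero_of_lt h2] at this
      simpa using this
    simp [this]

end IsLiZMetric

lemma vacuumDescendants_two_le : A.vacuumDescendants 2 ≤ ℂ ∙ A.conformal := by
  refine Submodule.span_le.mpr ?_
  rintro _ ⟨l, hl, hs, rfl⟩
  obtain rfl | rfl : l = [2] ∨ l = [1, 1] := by
    match l, hl, hs with
    | [], _, hs => simp at hs
    | [i], _, hs => simp_all
    | [i, j], hl, hs =>
      simp at hl hs
      right
      obtain rfl : i = 1 := by lia
      obtain rfl : j = 1 := by lia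
      rfl
    | i :: j :: k :: l, hl, hs =>
      simp at hl hs
      lia
  · simp [L_neg_two_vac]
  · simp [A.L_vac]

section Casimir

variable {A} {B : LinearMap.BilinForm ℂ V} (hB : A.IsLiZMetric B)
  {ι : Type*} [Fintype ι] [DecidableEq ι] (u : Module.Basis ι ℂ A.lieAlgebra)
  (u' : ι → A.lieAlgebra) (hu : ∀ i j, B (u' i : V) (u j : V) = if i = j then 1 else 0)
include hu

lemma repr_eq_of_dual (x : A.lieAlgebra) (i : ι) : u.repr x i = B (u' i : V) (x : V) := by
  conv_rhs => rw [← u.sum_repr x]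
  simp only [Submodule.coe_sum, Submodule.coe_smul, map_sum, map_smul, hu]
  simp

lemma sum_apply_mul_apply (x y : A.lieAlgebra) :
    ∑ i, B (u' i : V) (x : V) * B (y : V) (u i : V) = B (y : V) (x : V) := by
  conv_rhs => rw [← u.sum_repr x]
  simp only [Submodule.coe_sum, Submodule.coe_smul, map_sum, map_smul, repr_eq_of_dual u u' hu,
    smul_eq_mul]

lemma killingForm_eq_sum (a b : A.lieAlgebra) :
    killingForm ℂ A.lieAlgebra a b =
      ∑ i, B (u' i : V) (A.mode 0 (a : V) (A.mode 0 (b : V) (u i : V))) := by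
  rw [killingForm_apply_apply, LinearMap.trace_eq_matrix_trace ℂ u, Matrix.trace]
  refine Finset.sum_congr rfl fun i _ ↦ ?_
  rw [Matrix.diag_apply, LinearMap.toMatrix_apply, repr_eq_of_dual u u' hu]
  rfl

include hB

/-- The multiple of ω is detected by L₂, each dual pair contributing -𝟏; solving for it needs C ≠ 0.
-/
lemma casimir_eq_smul_conformal (hcas : A.casimir u u' 2 ∈ A.vacuumDescendants 2)
    (hC : A.centralCharge ≠ 0) :
    A.casimir u u' 2 = (-2 * (finrank ℂ A.lieAlgebra : ℂ) / A.centralCharge) • A.conformal := by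
  obtain ⟨t, ht⟩ := Submodule.mem_span_singleton.mp (A.vacuumDescendants_two_le hcas)
  have h : A.L 2 (A.casimir u u' 2) = -(finrank ℂ A.lieAlgebra : ℂ) • A.vac := by
    have h1 (i : ι) : A.L 2 (A.mode (1 - (2 : ℕ)) (u' i : V) (u i : V)) = -(1 : ℂ) • A.vac := by
      rw [show (1 - (2 : ℕ) : ℤ) = -1 by norm_num, hB.L_two_mode_neg_one (u' i).2 (u i).2, hu,
        if_pos rfl]
    rw [casimir, map_sum, Finset.sum_congr rfl fun i _ ↦ h1 i, finrank_eq_card_basis u]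
    simp [← Nat.cast_smul_eq_nsmul ℂ]
  rw [← ht, map_smul, L_two_conformal, smul_smul] at h
  have h2 := smul_left_injective ℂ A.vac_ne_zero h
  rw [← ht]
  congr 1
  field_simp
  linear_combination 2 * h2

/-- The Killing form of `V₁` is proportional to the metric. -/
lemma killingForm_eq (hcas : A.casimir u u' 2 ∈ A.vacuumDescendants 2)
    (hC : A.centralCharge ≠ 0) (a b : A.lieAlgebra) :
    killingForm ℂ A.lieAlgebra a b =
      -2 * B (a : V) (b : V) * ((finrank ℂ A.lieAlgebra : ℂ) / A.centralCharge - 1) := by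
  have h1 : B (a : V) (A.mode 1 (A.casimir u u' 2) (b : V)) =
      -2 * (finrank ℂ A.lieAlgebra : ℂ) / A.centralCharge * B (a : V) (b : V) := by
    have e : A.mode 1 A.conformal (b : V) = b := by simpa [L] using A.L_zero_of_mem b.2
    rw [casimir_eq_smul_conformal hB u u' hu hcas hC, map_smul, LinearMap.smul_apply, e, map_smul,
      smul_eq_mul]
  have hneg {x : V} (hx : x ∈ A.weightSpace 1) : A.mode (-1) x A.vac = x := A.mode_neg_one_vac x
  -- The outer Borcherds terms are rank one and each sum to -⟨a,b⟩ over the dual bases. The middle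
  -- one becomes a diagonal entry of ad b ∘ ad a.
  have h2 (i : ι) : B (a : V) (A.mode 1 (A.mode (1 - (2 : ℕ)) (u' i : V) (u i : V)) (b : V)) =
      -(B (u' i : V) (a : V) * B (b : V) (u i : V)) -
        B (u' i : V) (b : V) * B (a : V) (u i : V) +
        B (u' i : V) (A.mode 0 (b : V) (A.mode 0 (a : V) (u i : V))) := by
    have e1 : B (a : V) (A.mode 0 (u i : V) (A.mode 0 (u' i : V) (b : V))) =
        B (u' i : V) (A.mode 0 (b : V) (A.mode 0 (a : V) (u i : V))) := by
      rw [hB.apply_mode (u i).2, neg_zero, A.mode_zero_skew a.2 (u i).2,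
        A.mode_zero_skew b.2 (u' i).2, hB.apply_mode b.2, neg_zero]
      simp [hB.apply_comm]
    rw [show (1 - (2 : ℕ) : ℤ) = -1 by norm_num,
      A.mode_one_mode_neg_one (u' i).2 (u i).2 b.2, hB.mode_one (u i).2 b.2,
      hB.mode_one (u' i).2 b.2, map_add, map_add, e1, map_smul, map_smul, map_smul, map_smul,
      hneg (u i).2, hneg (u' i).2, hB.apply_comm (u i) b, hB.apply_comm a (u' i)]
    simp only [smul_eq_mul]
    ring
  have h3 : B (a : V) (A.mode 1 (A.casimir u u' 2) (b : V)) =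
      -2 * B (a : V) (b : V) + killingForm ℂ A.lieAlgebra a b := by
    rw [casimir, map_sum, LinearMap.sum_apply, map_sum, Finset.sum_congr rfl fun i _ ↦ h2 i,
      Finset.sum_add_distrib, Finset.sum_sub_distrib, Finset.sum_neg_distrib,
      sum_apply_mul_apply u u' hu, sum_apply_mul_apply u u' hu, ← killingForm_eq_sum u u' hu,
      LieModule.traceForm_comm ℂ A.lieAlgebra A.lieAlgebra b a, hB.apply_comm b a]
    ring
  rw [h1] at h3
  linear_combination -h3

end Casimir

end VertexOperatorAlgebra

/-! ### Killing lengths of coroots. -/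

section RootData

variable {L : Type*} [LieRing L] [LieAlgebra ℂ L] [FiniteDimensional ℂ L]
  [LieAlgebra.IsKilling ℂ L] {H : LieSubalgebra ℂ L} [H.IsCartanSubalgebra]

open LieAlgebra.IsKilling

lemma corootForm_coroot_eq_killingForm (α : H.root) :
    (rootSystem H).CorootForm ((rootSystem H).coroot α) ((rootSystem H).coroot α) =
      killingForm ℂ L (coroot (α : LieModule.Weight ℂ H L) : L)
        (coroot (α : LieModule.Weight ℂ H L) : L) := by
  rw [corootForm_rootSystem_eq_killing]
  rfl

lemma killingForm_coroot_self_ne_zero (α : H.root) :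
    killingForm ℂ L (coroot (α : LieModule.Weight ℂ H L) : L)
      (coroot (α : LieModule.Weight ℂ H L) : L) ≠ 0 := by
  rw [← corootForm_coroot_eq_killingForm]
  exact ((rootSystem H).flip.posRootForm ℤ).form_apply_root_ne_zero α

/-- In a simple Lie algebra, the coroots of long roots all have the same Killing length. -/
lemma IsLongRoot.killingForm_coroot_eq [LieAlgebra.IsSimple ℂ L] {α β : H.root}
    (hα : IsLongRoot α) (hβ : IsLongRoot β) :
    killingForm ℂ L (coroot (α : LieModule.Weight ℂ H L) : L)
        (coroot (α : LieModule.Weight ℂ H L) : L) =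
      killingForm ℂ L (coroot (β : LieModule.Weight ℂ H L) : L)
        (coroot (β : LieModule.Weight ℂ H L) : L) := by
  rw [← corootForm_coroot_eq_killingForm, ← corootForm_coroot_eq_killingForm]
  have h := RootPairing.rootForm_mul_corootForm_eq (P := rootSystem H) α β
  have h2 : (rootSystem H).RootForm ((rootSystem H).root α) ((rootSystem H).root α) =
      (rootSystem H).RootForm ((rootSystem H).root β) ((rootSystem H).root β) := by
    have e (γ : H.root) := ((rootSystem H).posRootForm ℤ).algebraMap_rootLength γ
    exact ((e α).symm.trans (congr_arg _ (le_antisymm (hβ α) (hα β)))).trans (e β)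
  rw [h2] at h
  exact mul_left_cancel₀ (((rootSystem H).posRootForm ℤ).form_apply_root_ne_zero β) h

/-- In a simple Lie algebra, the coroot of a long root has Killing length `4 h^∨`. -/
lemma IsDualCoxeterNumber.killingForm_coroot [LieAlgebra.IsSimple ℂ L] {h : ℤ}
    (hh : IsDualCoxeterNumber H h) {α : H.root} (hα : IsLongRoot α) :
    killingForm ℂ L (coroot (α : LieModule.Weight ℂ H L) : L)
      (coroot (α : LieModule.Weight ℂ H L) : L) = 4 * (h : ℂ) := by
  obtain ⟨b, θ, hθ, rfl⟩ := hh
  have hlong : IsLongRoot θ :=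
    RootPairing.Base.rootLength_le_of_forall_sub_mem_closure _ hθ
  rw [hα.killingForm_coroot_eq hlong, ← corootForm_coroot_eq_killingForm,
    RootPairing.Base.corootForm_coroot_self_of_forall_sub_mem_closure hθ]

end RootData

/-! ### Orthogonality of distinct simple ideals. -/

section Ideals

variable {L : Type*} [LieRing L] [LieAlgebra ℂ L]

lemma LieAlgebra.inf_eq_bot_of_isSimple_of_ne {I J : LieIdeal ℂ L} (hI : LieAlgebra.IsSimple ℂ I)
    (hJ : LieAlgebra.IsSimple ℂ J) (hIJ : I ≠ J) : I ⊓ J = ⊥ := by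
  -- I ∩ J is an ideal of the simple algebra I, hence zero or all of I.
  have key {I J : LieIdeal ℂ L} (hI : LieAlgebra.IsSimple ℂ I) : I ⊓ J = ⊥ ∨ I ≤ J := by
    rcases hI.eq_bot_or_eq_top (J.comap I.incl) with h | h
    · left
      rw [eq_bot_iff]
      intro x hx
      have hx2 : (⟨x, hx.1⟩ : I) ∈ J.comap I.incl := by
        rw [LieIdeal.mem_comap]
        exact hx.2
      rw [h, LieSubmodule.mem_bot] at hx2
      exact congr_arg Subtype.val hx2
    · right
      intro x hx
      have hx2 : (⟨x, hx⟩ : I) ∈ J.comap I.incl := h ▸ LieSubmodule.mem_top _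
      rw [LieIdeal.mem_comap] at hx2
      exact hx2
  rcases key (J := J) hI with h | h
  · exact h
  · rcases key (J := I) hJ with h' | h'
    · rwa [inf_comm]
    · exact absurd (le_antisymm h h') hIJ

lemma LieIdeal.lie_eq_zero_of_inf_eq_bot {I J : LieIdeal ℂ L} (h : I ⊓ J = ⊥) {x y : L}
    (hx : x ∈ I) (hy : y ∈ J) : ⁅x, y⁆ = 0 := by
  have : ⁅x, y⁆ ∈ I ⊓ J := ⟨lie_mem_left ℂ L I x y hx, lie_mem_right ℂ L J x y hy⟩
  rwa [h, LieSubmodule.mem_bot] at this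

lemma LieIdeal.killingForm_eq_zero_of_inf_eq_bot {I J : LieIdeal ℂ L} (h : I ⊓ J = ⊥) {x y : L}
    (hx : x ∈ I) (hy : y ∈ J) : killingForm ℂ L x y = 0 := by
  rw [killingForm_apply_apply]
  have : LieAlgebra.ad ℂ L x ∘ₗ LieAlgebra.ad ℂ L y = 0 := by
    ext z
    exact LieIdeal.lie_eq_zero_of_inf_eq_bot h hx (lie_mem_left ℂ L J y z hy)
  rw [this, map_zero]

end Ideals

/-! ### Semisimplicity and levels. -/

namespace VertexOperatorAlgebra

variable {V : Type*} [AddCommGroup V] [Module ℂ V] {A : VertexOperatorAlgebra V}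
  {B : LinearMap.BilinForm ℂ V}

/-- The restriction of a bilinear form on `V` to an ideal of `V₁`. -/
def restrictForm (B : LinearMap.BilinForm ℂ V) (I : LieIdeal ℂ A.lieAlgebra) :
    LinearMap.BilinForm ℂ I :=
  (B.restrict (A.weightSpace 1)).restrict I.toSubmodule

lemma isKilling_of_killingForm_eq {ι : Type*} [Fintype ι] [DecidableEq ι]
    (u : Module.Basis ι ℂ A.lieAlgebra) (u' : ι → A.lieAlgebra)
    (hu : ∀ i j, B (u' i : V) (u j : V) = if i = j then 1 else 0) {c : ℂ} (hc : c ≠ 0)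
    (hK : ∀ a b : A.lieAlgebra, killingForm ℂ A.lieAlgebra a b = c * B (a : V) (b : V)) :
    LieAlgebra.IsKilling ℂ A.lieAlgebra where
  killingCompl_top_eq_bot := by
    rw [eq_bot_iff]
    intro x hx
    rw [LieSubmodule.mem_bot]
    refine u.ext_elem fun i ↦ ?_
    have h : killingForm ℂ A.lieAlgebra (u' i) x = 0 :=
      (LieIdeal.mem_killingCompl ℂ A.lieAlgebra ⊤).mp hx (u' i) (LieSubmodule.mem_top _)
    rw [hK] at h
    rw [repr_eq_of_dual u u' hu, (mul_eq_zero.mp h).resolve_left hc]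
    simp

lemma IsLiZMetric.commute_mode (hB : A.IsLiZMetric B) {a b : A.lieAlgebra} (h0 : ⁅a, b⁆ = 0)
    (h1 : B (a : V) (b : V) = 0) (m n : ℤ) :
    Commute (A.mode m (a : V)) (A.mode n (b : V)) := by
  ext v
  have h0' : A.mode 0 (a : V) (b : V) = 0 := congr_arg Subtype.val h0
  have h := hB.mode_commutator a.2 b.2 m n v
  rw [h0', h1, map_zero, LinearMap.zero_apply, mul_zero, ite_self, zero_smul, add_zero] at h
  exact sub_eq_zero.mp h

lemma IsLiZMetric.apply_lie (hB : A.IsLiZMetric B) (x y z : A.lieAlgebra) :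
    B ((⁅x, y⁆ : A.lieAlgebra) : V) (z : V) = B (x : V) ((⁅y, z⁆ : A.lieAlgebra) : V) := by
  change B (A.mode 0 (x : V) (y : V)) (z : V) = B (x : V) (A.mode 0 (y : V) (z : V))
  rw [hB.apply_mode y.2, neg_zero, A.mode_zero_skew x.2 y.2, map_neg, LinearMap.neg_apply, neg_neg]

section Level

variable (hB : A.IsLiZMetric B) {c : ℂ} (hc : c ≠ 0)
  (hK : ∀ a b : A.lieAlgebra, killingForm ℂ A.lieAlgebra a b = c * B (a : V) (b : V))
  {I : LieIdeal ℂ A.lieAlgebra} [LieAlgebra.IsKilling ℂ I]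
  (H : LieSubalgebra ℂ I) [H.IsCartanSubalgebra]
include hK

lemma killingForm_coroot_eq_rootLevel (α : H.root) :
    killingForm ℂ I (LieAlgebra.IsKilling.coroot (α : LieModule.Weight ℂ H I) : I)
      (LieAlgebra.IsKilling.coroot (α : LieModule.Weight ℂ H I) : I) =
      -2 * c * A.rootLevel H B α := by
  rw [LieIdeal.killingForm_eq]
  refine (hK _ _).trans ?_
  have e (x : ℂ) : c * x = -2 * c * (-(1 / 2) * x) := by ring
  exact e _

include hB hc

/-- The normalized form must be -k⁻¹⟨ , ⟩: it takes the value 2 at α^∨ because ⟨α^∨,α^∨⟩ = -2k, and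
at every other long coroot because their lengths agree. Multiplying by mk recovers the central term
-m⟨a,b⟩. -/
lemma hasKacMoodyLevel_rootLevel [LieAlgebra.IsSimple ℂ I] {α : H.root} (hα : IsLongRoot α) :
    A.HasKacMoodyLevel H (A.rootLevel H B α) := by
  set k := A.rootLevel H B α
  have hk0 : k ≠ 0 := by
    have h := killingForm_coroot_self_ne_zero α
    rw [killingForm_coroot_eq_rootLevel hK] at h
    exact right_ne_zero_of_mul h
  have hform (x y : I) : (-k⁻¹ • restrictForm B I) x y =
      -k⁻¹ * B ((x : A.lieAlgebra) : V) ((y : A.lieAlgebra) : V) := rfl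
  refine ⟨-k⁻¹ • restrictForm B I, ⟨⟨fun x y ↦ ?_⟩, fun x y z ↦ ?_, fun β hβ ↦ ?_⟩,
    fun a b m n v ↦ ?_⟩
  · rw [hform, hform, hB.apply_comm]
  · rw [hform, hform]
    exact congr_arg _ (hB.apply_lie x y z)
  · have h := hα.killingForm_coroot_eq hβ
    rw [killingForm_coroot_eq_rootLevel hK, killingForm_coroot_eq_rootLevel hK] at h
    have h2 : k = A.rootLevel H B β := mul_left_cancel₀ (by simpa using hc) h
    rw [hform]
    rw [rootLevel] at h2
    field_simp
    linear_combination -2 * h2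
  · rw [hB.mode_commutator a.1.2 b.1.2 m n v, hform]
    congr 2
    split_ifs
    · field_simp
    · rfl

end Level

end VertexOperatorAlgebra

end

theorem mainTheorem10 {V : Type*} [AddCommGroup V] [Module ℂ V] (A : VertexOperatorAlgebra V)
    (B : LinearMap.BilinForm ℂ V) (hB : A.IsLiZMetric B)
    {ι : Type*} [Fintype ι] [DecidableEq ι] (u : Module.Basis ι ℂ A.lieAlgebra)
    (u' : ι → A.lieAlgebra) (hu : ∀ i j, B (u' i : V) (u j : V) = if i = j then 1 else 0)
    (hcas : A.casimir u u' 2 ∈ A.vacuumDescendants 2) (hC : A.centralCharge ≠ 0) :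
    (∀ a b : A.lieAlgebra, killingForm ℂ A.lieAlgebra a b =
      -2 * B (a : V) (b : V) * ((Module.finrank ℂ A.lieAlgebra : ℂ) / A.centralCharge - 1)) ∧
    ((Module.finrank ℂ A.lieAlgebra : ℂ) = A.centralCharge →
      LieAlgebra.IsSolvable A.lieAlgebra) ∧
    ((Module.finrank ℂ A.lieAlgebra : ℂ) ≠ A.centralCharge →
      LieAlgebra.IsSemisimple ℂ A.lieAlgebra ∧
      (∀ (I J : LieIdeal ℂ A.lieAlgebra), LieAlgebra.IsSimple ℂ I → LieAlgebra.IsSimple ℂ J →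
        I ≠ J → ∀ a ∈ I, ∀ b ∈ J, ∀ m n : ℤ,
          Commute (A.mode m (a : V)) (A.mode n (b : V))) ∧
      ∀ (I : LieIdeal ℂ A.lieAlgebra) [LieAlgebra.IsSimple ℂ I]
        (H : LieSubalgebra ℂ I) [H.IsCartanSubalgebra] (α : H.root), IsLongRoot α →
          A.HasKacMoodyLevel H (A.rootLevel H B α) ∧
          ∀ h : ℤ, IsDualCoxeterNumber H h →
            (h : ℂ) = A.rootLevel H B α *
              ((Module.finrank ℂ A.lieAlgebra : ℂ) / A.centralCharge - 1)) := by
  have hK := VertexOperatorAlgebra.killingForm_eq hB u u' hu hcas hC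
  refine ⟨hK, fun hd ↦ ?_, fun hd ↦ ?_⟩
  -- Cartan's criterion, with K identically zero.
  · refine LieAlgebra.isSolvable_of_killingForm_apply_lie_eq_zero (R := ℂ) fun x y _ ↦ ?_
    rw [hK, hd, div_self hC, sub_self, mul_zero]
  set c : ℂ := -2 * ((Module.finrank ℂ A.lieAlgebra : ℂ) / A.centralCharge - 1) with hc
  have hc0 : c ≠ 0 := by
    refine mul_ne_zero (by norm_num) (sub_ne_zero.mpr fun h ↦ hd ?_)
    exact (div_eq_one_iff_eq hC).mp h
  replace hK (a b : A.lieAlgebra) :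
      killingForm ℂ A.lieAlgebra a b = c * B (a : V) (b : V) := by
    rw [hK, hc]
    ring
  have := VertexOperatorAlgebra.isKilling_of_killingForm_eq u u' hu hc0 hK
  refine ⟨inferInstance, fun I J hI hJ hIJ a ha b hb m n ↦ ?_, fun I _ H _ α hα ↦ ?_⟩
  · have hbot := LieAlgebra.inf_eq_bot_of_isSimple_of_ne hI hJ hIJ
    have h := LieIdeal.killingForm_eq_zero_of_inf_eq_bot hbot ha hb
    rw [hK] at h
    exact hB.commute_mode (LieIdeal.lie_eq_zero_of_inf_eq_bot hbot ha hb)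
      ((mul_eq_zero.mp h).resolve_left hc0) m n
  · refine ⟨VertexOperatorAlgebra.hasKacMoodyLevel_rootLevel hB hc0 hK H hα, fun h hh ↦ ?_⟩
    -- Two values of K(α^∨,α^∨) are compared: 4h and -2ck, where c = -2(d₁/C - 1).
    have h1 := hh.killingForm_coroot hα
    rw [VertexOperatorAlgebra.killingForm_coroot_eq_rootLevel hK, hc] at h1
    linear_combination -(1 / 4) * h1
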